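/- A \emph{triangulation} $t$ is a rooted map all of whose faces have degree $3$: a finite graph (loops and multiple edges allowed) with a distinguished oriented edge, embedded in a compact connected oriented surface $S$; equivalently, $S$ is obtained by gluing finitely many triangles along their sides. A \emph{path} is a finite sequence of consecutive oriented edges, with vertices $v_0,\dots,v_\ell$ ($\ell$ is its \emph{length}); it is \emph{simple} if its vertices are pairwise distinct. A \emph{cycle} is a path with $v_0=v_\ell$; it is \emph{simple} if $\ell\ge 1$ and its vertices are pairwise distinct except for $v_0=v_\ell$. Cycles are regarded as oriented closed curves on $S$: two cycles are \emph{homotopic} if they are freely homotopic as oriented closed curves, a cycle is \emph{contractible} if it is homotopic to a point, and \emph{separating} if its class in $H_1(S)$, the abelianization of the fundamental group, is zero. The \emph{separating systole} of $t$ is the minimal length of a separating non-contractible cycle (it is $\infty$ if there is none). A \emph{thin eight} is either (a) a triple $(c_1,c_2,p)$ where $c_1,c_2$ are simple non-separating cycles without common vertex which are not homotopic, and $p$ is a simple path from a vertex of $c_1$ to a vertex of $c_2$ with no other vertex on $c_1$ or $c_2$; its total length is $|c_1|+|c_2|+|p|$; or (b) a pair $(c_1,c_2)$ of simple non-separating cycles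 that have exactly one vertex and no edge in common and do not cross transversely at that vertex (i.e. in the cyclic order around it the ends of $c_1$ and $c_2$ do not alternate); its total length is $|c_1|+|c_2|$. A \emph{fat eight} is either (a) a pair $(c,p)$ where $c$ is a simple non-separating cycle and $p$ is a simple path from the starting point of $c$ to a vertex of $c$, with no other vertex and no edge in common with $c$, such that, writing $c=qr^{-1}$ with $q,r$ simple paths having the same starting point and endpoint as $p$, neither of the cycles $pr^{-1}$ and $qp^{-1}$ is contractible; its total length is $|c|+|p|$; or (b) a pair $(c_1,c_2)$ of simple non-separating cycles that have exactly one vertex and no edge in common and cross transversely at that vertex (the ends of $c_1$ and $c_2$ alternate around it); its total length is $|c_1|+|c_2|$. \textbf{Theorem.} Let $t$ be a triangulation whose separating systole is $L<\infty$. Then $t$ contains at least one of the following: (i) a simple non-contractible separating cycle of length at most $L$; (ii) a thin eight of total length at most $L$; (iii) a fat eight of total length at most $L$. -/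

import Mathlib

open scoped unitInterval

noncomputable section

universe u

/-- A rooted triangulation of a compact connected oriented surface, given by the gluing of finitely
many oriented triangles along their sides (loops and multiple edges are allowed).

`D` is the finite set of *darts* (oriented edges, equivalently sides of triangles). Each dart `d`
runs along one side of exactly one face, the face on its right; `next d` is the dart that follows
`d` along the boundary of that face, and `rev d` is the same edge with the opposite orientation.
Every face has degree three: each orbit of `next` has exactly three elements. -/
structure Triangulation (D : Type u) where
  next : Equiv.Perm D
  rev : Equiv.Perm D
  next_next_next : ∀ d, next (next (next d)) = d
  next_ne : ∀ d, next d ≠ d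
  rev_rev : ∀ d, rev (rev d) = d
  rev_ne : ∀ d, rev d ≠ d
  connected : ∀ d e, ∃ g ∈ Subgroup.closure {next, rev}, g d = e
  root : D

namespace Triangulation

variable {D : Type u} (t : Triangulation D)

/-! ### Vertices and edges -/

/-- Rotation around vertices: `rot d` is the dart that comes next after `d` when one turns (in a
fixed direction) around the starting point of `d`. -/
def rot : Equiv.Perm D := t.next * t.rev

/-- The vertices are the orbits of the rotation. -/
def Vertex : Type u := Quotient (Equiv.Perm.SameCycle.setoid t.rot)

/-- Starting point of a dart. -/
def src (d : D) : t.Vertex := Quotient.mk (Equiv.Perm.SameCycle.setoid t.rot) d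

/-- Endpoint of a dart. -/
def tgt (d : D) : t.Vertex := t.src (t.rev d)

/-- The graph of the triangulation; its arrows are the darts. -/
instance : Quiver t.Vertex where
  Hom u v := {d : D // t.src d = u ∧ t.tgt d = v}

instance : Quiver.HasReverse t.Vertex where
  reverse' := fun e => ⟨t.rev e.1, e.2.2, (congrArg t.src (t.rev_rev e.1)).trans e.2.1⟩

/-- A path of the triangulation from `u` to `v`: a finite sequence of consecutive darts.
A cycle is an element of `t.Walk v v`. -/
abbrev Walk (u v : t.Vertex) : Type u := Quiver.Path u v

/-- The sequence of darts of a path. -/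
def darts {u : t.Vertex} : ∀ {v : t.Vertex}, t.Walk u v → List D
  | _, Quiver.Path.nil => []
  | _, Quiver.Path.cons p e => darts p ++ [e.1]

/-- A path is simple if its vertices `v₀, …, v_ℓ` are pairwise distinct. -/
def IsSimplePath {u v : t.Vertex} (p : t.Walk u v) : Prop := p.vertices.Nodup

/-- A (nonempty) cycle is simple if its vertices are pairwise distinct except for `v₀ = v_ℓ`, i.e.
if `v₁, …, v_ℓ` are pairwise distinct. -/
def IsSimpleCycle {v : t.Vertex} (c : t.Walk v v) : Prop :=
  0 < c.length ∧ c.vertices.tail.Nodup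

/-- Two paths share an (unoriented) edge. -/
def ShareEdge {u v u' v' : t.Vertex} (p : t.Walk u v) (q : t.Walk u' v') : Prop :=
  ∃ d ∈ t.darts p, d ∈ t.darts q ∨ t.rev d ∈ t.darts q

/-! ### The surface

The surface is the quotient of a disjoint union of triangles. There is one copy of the triangle for
each dart `d`, in which the vertices `0`, `1`, `2` are the starting point of `d`, the endpoint of
`d` and the third corner of the face to the right of `d`. The three copies which belong to the same
face are identified with one another, and the faces are then glued along the edges. -/

/-- The gluing relation. First clause: the copies for `d` and `next d` represent the same face.
Second clause: the side `d` of a face is glued to the side `rev d`, with opposite orientations. -/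
def Glue (a b : Σ _ : D, stdSimplex ℝ (Fin 3)) : Prop :=
  (b.1 = t.next a.1 ∧
    b.2.1 0 = a.2.1 1 ∧ b.2.1 1 = a.2.1 2 ∧ b.2.1 2 = a.2.1 0) ∨
  (b.1 = t.rev a.1 ∧ a.2.1 2 = 0 ∧
    b.2.1 0 = a.2.1 1 ∧ b.2.1 1 = a.2.1 0 ∧ b.2.1 2 = 0)

/-- The surface of the triangulation. -/
def Surface : Type u := Quot t.Glue

instance : TopologicalSpace t.Surface :=
  inferInstanceAs (TopologicalSpace (Quot t.Glue))

/-- The point of the side `0`–`1` of the triangle at parameter `s`, starting from the corner `0`. -/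
def sidePoint (s : I) : stdSimplex ℝ (Fin 3) :=
  ⟨![1 - (s : ℝ), s, 0], by
    refine ⟨fun i => ?_, ?_⟩
    · fin_cases i
      · exact sub_nonneg.2 s.2.2
      · exact s.2.1
      · exact le_refl _
    · simp [Fin.sum_univ_three]⟩

/-- The point at parameter `s` of the dart `d`, on the surface. -/
def dartPoint (d : D) (s : I) : t.Surface := Quot.mk t.Glue ⟨d, sidePoint s⟩

theorem dartPoint_rev (d : D) (s : I) : t.dartPoint (t.rev d) (unitInterval.symm s) =
    t.dartPoint d s := by
  refine (Quot.sound (r := t.Glue) (Or.inr ⟨rfl, ?_, ?_, ?_, ?_⟩)).symm <;> simp [sidePoint]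

theorem dartPoint_next (d : D) : t.dartPoint (t.next d) 0 = t.dartPoint d 1 := by
  refine (Quot.sound (r := t.Glue) (Or.inl ⟨rfl, ?_, ?_, ?_⟩)).symm <;> simp [sidePoint]

theorem dartPoint_rot (d : D) : t.dartPoint (t.rot d) 0 = t.dartPoint d 0 := by
  have h := t.dartPoint_rev d 0
  rw [unitInterval.symm_zero] at h
  exact (t.dartPoint_next (t.rev d)).trans h

theorem dartPoint_of_sameCycle {d e : D} (h : t.rot.SameCycle d e) :
    t.dartPoint d 0 = t.dartPoint e 0 := by
  obtain ⟨n, rfl⟩ := h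
  induction n using Int.induction_on with
  | zero => simp
  | succ n ih =>
    rw [add_comm, zpow_add, zpow_one, Equiv.Perm.mul_apply, dartPoint_rot, ih]
  | pred n ih =>
    rw [ih, ← t.dartPoint_rot ((t.rot ^ (-(n : ℤ) - 1)) d), ← Equiv.Perm.mul_apply,
      ← zpow_one_add]
    congr 3
    ring

/-- The point of the surface at which a vertex sits. -/
def vertexPoint : t.Vertex → t.Surface :=
  Quotient.lift (fun d => t.dartPoint d 0) fun _ _ h => t.dartPoint_of_sameCycle h

/-- A dart, seen as a continuous path on the surface. -/
def dartCurve (d : D) : Path (t.vertexPoint (t.src d)) (t.vertexPoint (t.tgt d)) where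
  toFun s := t.dartPoint d s
  continuous_toFun := by
    refine continuous_quot_mk.comp (continuous_sigmaMk.comp ?_)
    refine Continuous.subtype_mk (continuous_pi fun i => ?_) _
    fin_cases i
    · exact continuous_const.sub continuous_subtype_val
    · exact continuous_subtype_val
    · exact continuous_const
  source' := rfl
  target' := by
    have h := t.dartPoint_rev d 1
    rw [unitInterval.symm_one] at h
    exact h.symm

/-- A path of the triangulation, seen as a continuous path on the surface. -/
def curve {u : t.Vertex} : ∀ {v : t.Vertex}, t.Walk u v →
    Path (t.vertexPoint u) (t.vertexPoint v)
  | _, Quiver.Path.nil => Path.refl _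
  | _, Quiver.Path.cons p e => (curve p).trans
      ((t.dartCurve e.1).cast (congrArg t.vertexPoint e.2.1.symm)
        (congrArg t.vertexPoint e.2.2.symm))

end Triangulation

/-! ### Homotopy and homology of closed curves -/

/-- Free homotopy of (oriented, parametrized) closed curves: one can be continuously deformed into
the other through closed curves. -/
def FreelyHomotopic {X : Type u} [TopologicalSpace X] {x y : X} (p : Path x x) (q : Path y y) :
    Prop :=
  ∃ H : C(I × I, X), (∀ s, H (0, s) = p s) ∧ (∀ s, H (1, s) = q s) ∧
    ∀ r, H (r, 0) = H (r, 1)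

/-- The class of a closed curve in the first homology group, i.e. in the abelianization of the
fundamental group. -/
def homologyClass {X : Type u} [TopologicalSpace X] {x : X} (p : Path x x) :
    Abelianization (FundamentalGroup X x) :=
  Abelianization.of (FundamentalGroup.fromPath (Path.Homotopic.Quotient.mk p))

namespace Triangulation

variable {D : Type u} (t : Triangulation D)

/-- Two cycles are homotopic if they are freely homotopic as oriented closed curves on the
surface. -/
def Homotopic {u v : t.Vertex} (c : t.Walk u u) (c' : t.Walk v v) : Prop :=
  FreelyHomotopic (t.curve c) (t.curve c')

/-- A cycle is contractible if it is homotopic to a single point of the surface. -/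
def IsContractible {v : t.Vertex} (c : t.Walk v v) : Prop :=
  ∃ x : t.Surface, FreelyHomotopic (t.curve c) (Path.refl x)

/-- A cycle is separating if it is null-homologous. -/
def IsSeparating {v : t.Vertex} (c : t.Walk v v) : Prop :=
  homologyClass (t.curve c) = 1

/-- The separating systole: the length of the shortest separating non-contractible cycle (and
`⊤` if there is no such cycle). -/
def separatingSystole : ℕ∞ :=
  ⨅ (v : t.Vertex) (c : t.Walk v v) (_ : ¬ t.IsContractible c ∧ t.IsSeparating c), (c.length : ℕ∞)

/-! ### Thin eights and fat eights -/

/-- Thin eights with disjoint cycles: two disjoint simple non-separating cycles that are not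
homotopic, and a simple path from the first to the second one that has no other vertex in common
with them. -/
structure IsThinEight {u v x y : t.Vertex} (c₁ : t.Walk u u) (c₂ : t.Walk v v) (p : t.Walk x y) :
    Prop where
  simple₁ : t.IsSimpleCycle c₁
  simple₂ : t.IsSimpleCycle c₂
  not_separating₁ : ¬ t.IsSeparating c₁
  not_separating₂ : ¬ t.IsSeparating c₂
  not_homotopic : ¬ t.Homotopic c₁ c₂
  disjoint : ∀ z ∈ c₁.vertices, z ∉ c₂.vertices
  simple_path : t.IsSimplePath p
  start_mem : x ∈ c₁.vertices
  end_mem : y ∈ c₂.vertices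
  eq_start : ∀ z ∈ p.vertices, z ∈ c₁.vertices → z = x
  eq_end : ∀ z ∈ p.vertices, z ∈ c₂.vertices → z = y

/-- Fat eights made of a cycle and a chord: `c` is a simple non-separating cycle, `p` is a simple
path from the starting point of `c` to another vertex of `c`, with no other vertex and no edge in
common with `c`, and, when `c = q r⁻¹` is cut at the endpoint of `p`, neither `p r⁻¹` nor `q p⁻¹`
is contractible. -/
structure IsFatEight {u w : t.Vertex} (c : t.Walk u u) (p : t.Walk u w) : Prop where
  simple : t.IsSimpleCycle c
  not_separating : ¬ t.IsSeparating c
  simple_path : t.IsSimplePath p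
  end_mem : w ∈ c.vertices
  eq_or_eq : ∀ z ∈ p.vertices, z ∈ c.vertices → z = u ∨ z = w
  not_shareEdge : ¬ t.ShareEdge p c
  chord : ∃ q r : t.Walk u w, t.IsSimplePath q ∧ t.IsSimplePath r ∧ c = q.comp r.reverse ∧
    ¬ t.IsContractible (p.comp r.reverse) ∧ ¬ t.IsContractible (q.comp p.reverse)

/-- Two simple non-separating cycles that meet at a single vertex `v`, taken as their common
starting point, and share no edge. -/
structure MeetOnce {v : t.Vertex} (c₁ c₂ : t.Walk v v) : Prop where
  simple₁ : t.IsSimpleCycle c₁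
  simple₂ : t.IsSimpleCycle c₂
  not_separating₁ : ¬ t.IsSeparating c₁
  not_separating₂ : ¬ t.IsSeparating c₂
  eq_of_mem : ∀ z ∈ c₁.vertices, z ∈ c₂.vertices → z = v
  not_shareEdge : ¬ t.ShareEdge c₁ c₂

/-- For darts `d ≠ e` with the same starting point, the set of darts met strictly after `d` and
strictly before `e` when turning around this point. -/
def sector (d e : D) : Set D :=
  {f | ∃ j : ℕ, 0 < j ∧ f = (t.rot ^ j) d ∧ ∀ i : ℕ, 0 < i → i ≤ j → (t.rot ^ i) d ≠ e}

/-- Two cycles with the same starting point `v` cross there: with `bᵢ` the first and `aᵢ` the last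
dart of `cᵢ`, the ends `rev a₁, b₁` of `c₁` at `v` alternate with the ends `rev a₂, b₂` of `c₂`,
i.e. exactly one of the latter two lies in the sector from `rev a₁` to `b₁`. -/
def CrossAtStart {v : t.Vertex} (c₁ c₂ : t.Walk v v) : Prop :=
  ∃ a₁ b₁ a₂ b₂ : D,
    (t.darts c₁).getLast? = some a₁ ∧ (t.darts c₁).head? = some b₁ ∧
    (t.darts c₂).getLast? = some a₂ ∧ (t.darts c₂).head? = some b₂ ∧
    Xor (t.rev a₂ ∈ t.sector (t.rev a₁) b₁) (b₂ ∈ t.sector (t.rev a₁) b₁)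

end Triangulation

end

noncomputable section

universe u

open CategoryTheory

/-! ### Generalities on paths -/

/-! Take a shortest separating non-contractible cycle. If it is not simple, it contains a simple
subcycle `a`, and after rotation it reads `a · b` with `b` a nonempty loop at the same vertex. By
minimality, neither `a` nor any nonempty subloop of `b` is separating: such a piece would be
contractible, and removing it would leave a shorter separating cycle in the same homotopy class.

Suppose now that no eight is short enough. Cut `b` at its visits to `a`. By
`isAlong_of_not_hasEight`, each excursion is homotopic to a path along `a`: a loop disjoint from `a`
would give a thin eight, an excursion returning to its starting point an eight with one common
vertex, and a chord a fat eight unless it can be pushed onto one of the two arcs of `a`. Hence `b`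
is homotopic to `a ^ k` for some integer `k`. In homology the class of `a` to the power `k + 1` is
trivial; since `a` is not separating and homology has no torsion, `k = -1`. Then `a · b` is
contractible, a contradiction (`hasEight_of_minimal`).

Absence of torsion is proved in `homology_eq_one_of_zpow_eq_one`. An integral cocycle on the darts
defines a map to the circle, so its sum over a torsion cycle vanishes. Chains modulo boundaries form
a free module, on which such cocycles separate points; a torsion cycle is therefore a boundary, and
boundaries have trivial homology class. The same fact shows that a non-separating cycle cannot be
freely homotopic to both orientations of another cycle, which supplies the non-homotopic pair
required in a thin eight. -/

theorem FreelyHomotopic.exists_conj {X : Type u} [TopologicalSpace X] {x y : X} {p : Path x x}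
    {q : Path y y} (h : FreelyHomotopic p q) :
    ∃ δ : FundamentalGroupoid.mk x ⟶ FundamentalGroupoid.mk y,
      FundamentalGroupoid.fromPath (.mk p) =
        δ ≫ FundamentalGroupoid.fromPath (.mk q) ≫ inv δ := by
  obtain ⟨H, h₀, h₁, h⟩ := h
  let F : p.toContinuousMap.Homotopy q.toContinuousMap :=
    { toContinuousMap := H, map_zero_left := h₀, map_one_left := h₁ }
  let δ : Path x y :=
    { toFun r := H (r, 0)
      continuous_toFun := by fun_prop
      source' := (h₀ 0).trans p.source
      target' := (h₁ 0).trans q.source }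
  -- The square `H` has `p` and `q` as two opposite sides. By `h` the other two sides are both the
  -- track `δ` of the base point.
  have key : (p.trans δ).Homotopic (δ.trans q) := by
    have h2 := Path.Homotopic.map_trans_evalAt F (Path.id)
    have h3 : (((Path.id.map (map_continuous p.toContinuousMap)).trans (F.evalAt 1)).cast
        p.source.symm q.target.symm).Homotopic
        (((F.evalAt 0).trans (Path.id.map (map_continuous q.toContinuousMap))).cast
        p.source.symm q.target.symm) := h2
    convert h3 using 1
    · ext s
      simp only [Path.trans_apply, Path.cast_coe]
      split_ifs
      · rfl
      · exact h _
    · ext s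
      simp only [Path.trans_apply, Path.cast_coe]
      split_ifs <;> rfl
  refine ⟨.mk δ, ?_⟩
  have h4 : FundamentalGroupoid.fromPath (.mk p) ≫ FundamentalGroupoid.fromPath (.mk δ) =
      FundamentalGroupoid.fromPath (.mk δ) ≫ FundamentalGroupoid.fromPath (.mk q) :=
    Path.Homotopic.Quotient.eq.2 key
  rw [← Category.assoc, IsIso.eq_comp_inv]
  exact h4

theorem Path.Homotopic.freelyHomotopic {X : Type u} [TopologicalSpace X] {x : X} {p q : Path x x}
    (h : p.Homotopic q) : FreelyHomotopic p q := by
  obtain ⟨F⟩ := h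
  exact ⟨F.toContinuousMap, F.map_zero_left, F.map_one_left, fun r =>
    (Path.Homotopy.source F r).trans (Path.Homotopy.target F r).symm⟩

/-- A triangle of paths is null-homotopic if it factors through a simply connected space. -/
theorem homotopic_refl_of_factor {X Y : Type*} [TopologicalSpace X] [TopologicalSpace Y]
    [SimplyConnectedSpace X] (F : C(X, Y)) {x y z : X} {a b c : Y} (ha : a = F x) (hb : b = F y)
    (hc : c = F z) {p : Path a b} {q : Path b c} {r : Path c a} (P : Path x y) (Q : Path y z)
    (R : Path z x) (hp : ∀ s, p s = F (P s)) (hq : ∀ s, q s = F (Q s)) (hr : ∀ s, r s = F (R s)) :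
    (p.trans (q.trans r)).Homotopic (Path.refl a) := by
  subst ha hb hc
  obtain rfl : p = P.map F.continuous := Path.ext (funext hp)
  obtain rfl : q = Q.map F.continuous := Path.ext (funext hq)
  obtain rfl : r = R.map F.continuous := Path.ext (funext hr)
  rw [← Path.map_trans, ← Path.map_trans]
  exact (SimplyConnectedSpace.paths_homotopic (P.trans (Q.trans R)) (Path.refl x)).map F

instance stdSimplex.simplyConnectedSpace {ι : Type*} [Fintype ι] [Nonempty ι] :
    SimplyConnectedSpace (stdSimplex ℝ ι) := by
  have := (convex_stdSimplex ℝ ι).contractibleSpace (by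
    classical
    exact ⟨_, single_mem_stdSimplex ℝ (Classical.arbitrary ι)⟩)
  infer_instance

namespace Triangulation

variable {D : Type u} (t : Triangulation D)

instance : Quiver.HasInvolutiveReverse t.Vertex where
  inv' := by rintro _ _ ⟨d, rfl, rfl⟩; exact Subtype.ext (t.rev_rev d)

/-! ### Homotopy classes of walks -/

/-- A vertex, as an object of the fundamental groupoid of the surface. -/
abbrev pt (v : t.Vertex) : FundamentalGroupoid t.Surface := ⟨t.vertexPoint v⟩

/-- The homotopy class of a dart. -/
def edgeClass {u v : t.Vertex} (e : u ⟶ v) : t.pt u ⟶ t.pt v :=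
  FundamentalGroupoid.fromPath (.mk ((t.dartCurve e.1).cast (congrArg t.vertexPoint e.2.1.symm)
        (congrArg t.vertexPoint e.2.2.symm)))

/-- The homotopy class of a walk. -/
def walkClass {u v : t.Vertex} (p : t.Walk u v) : t.pt u ⟶ t.pt v :=
  FundamentalGroupoid.fromPath (.mk (t.curve p))

@[simp]
theorem walkClass_nil (u : t.Vertex) : t.walkClass (Quiver.Path.nil : t.Walk u u) = 𝟙 _ := rfl

@[simp]
theorem walkClass_cons {u v w : t.Vertex} (p : t.Walk u v) (e : v ⟶ w) :
    t.walkClass (p.cons e) = t.walkClass p ≫ t.edgeClass e := rfl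

@[simp]
theorem walkClass_toPath {u v : t.Vertex} (e : u ⟶ v) :
    t.walkClass e.toPath = t.edgeClass e := by
  rw [Quiver.Hom.toPath, walkClass_cons, walkClass_nil, Category.id_comp]

@[simp]
theorem walkClass_comp {u v w : t.Vertex} (p : t.Walk u v) (q : t.Walk v w) :
    t.walkClass (p.comp q) = t.walkClass p ≫ t.walkClass q := by
  induction q with
  | nil => simp
  | cons q e ih => simp [ih]

@[simp]
theorem edgeClass_reverse {u v : t.Vertex} (e : u ⟶ v) :
    t.edgeClass (Quiver.reverse e) = inv (t.edgeClass e) := by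
  rw [← Groupoid.inv_eq_inv]
  obtain ⟨d, rfl, rfl⟩ := e
  refine congrArg Path.Homotopic.Quotient.mk ?_
  ext s
  have := t.dartPoint_rev d (unitInterval.symm s)
  rw [unitInterval.symm_symm] at this
  exact this

@[simp]
theorem walkClass_reverse {u v : t.Vertex} (p : t.Walk u v) :
    t.walkClass p.reverse = inv (t.walkClass p) := by
  induction p with
  | nil => simp
  | cons q e ih => simp [ih]

/-! ### Boundaries of faces -/

theorem src_rot (d : D) : t.src (t.rot d) = t.src d :=
  Quotient.sound (Equiv.Perm.sameCycle_apply_left.2 (Equiv.Perm.SameCycle.refl _ _))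

theorem tgt_eq_src_next (d : D) : t.tgt d = t.src (t.next d) := by
  rw [tgt, ← src_rot, rot, Equiv.Perm.mul_apply, t.rev_rev]

/-- A dart, seen as an arrow from its starting point to that of the next dart. -/
def nextEdge (d : D) : t.src d ⟶ t.src (t.next d) := ⟨d, rfl, t.tgt_eq_src_next d⟩

theorem src_next_next_next (d : D) : t.src (t.next (t.next (t.next d))) = t.src d :=
  congrArg t.src (t.next_next_next d)

/-- The third side of a face. -/
def lastEdge (d : D) : t.src (t.next (t.next d)) ⟶ t.src d :=
  ⟨t.next (t.next d), rfl, (t.tgt_eq_src_next _).trans (t.src_next_next_next d)⟩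

/-- The corners of the triangle. -/
def corner (i : Fin 3) : stdSimplex ℝ (Fin 3) := ⟨Pi.single i 1, single_mem_stdSimplex ℝ i⟩

/-- The point at parameter `s` of the side of the triangle from corner `i` to corner `j`. -/
def sideCurve (i j : Fin 3) : Path (corner i) (corner j) where
  toFun s := ⟨fun k => (1 - (s : ℝ)) * (corner i).1 k + s * (corner j).1 k, by
    refine (convex_stdSimplex ℝ (Fin 3)) (corner i).2 (corner j).2 (sub_nonneg.2 s.2.2) s.2.1 ?_
    ring⟩
  continuous_toFun := by
    refine Continuous.subtype_mk (continuous_pi fun k => ?_) _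
    fun_prop
  source' := by ext; simp
  target' := by ext; simp

theorem sideCurve_apply (i j k : Fin 3) (s : I) : (sideCurve i j s).1 k =
    (1 - (s : ℝ)) * (corner i).1 k + s * (corner j).1 k := rfl

theorem sideCurve_add_one (i j k : Fin 3) (s : I) :
    (sideCurve (i + 1) (j + 1) s).1 (k + 1) = (sideCurve i j s).1 k := by
  rw [sideCurve_apply, sideCurve_apply]
  simp only [corner, Pi.single_apply, add_left_inj]

/-- The face to the right of `d`, as a continuous map. -/
def faceMap (d : D) : C(stdSimplex ℝ (Fin 3), t.Surface) where
  toFun x := Quot.mk t.Glue ⟨d, x⟩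
  continuous_toFun := continuous_quot_mk.comp continuous_sigmaMk

theorem dartPoint_eq_faceMap (d : D) (s : I) :
    t.dartPoint d s = t.faceMap d (sideCurve 0 1 s) := by
  refine congrArg (fun x => Quot.mk t.Glue ⟨d, x⟩) (Subtype.ext (funext fun k => ?_))
  rw [sideCurve_apply]
  fin_cases k <;> simp [sidePoint, corner]

theorem faceMap_next (d : D) (x y : stdSimplex ℝ (Fin 3)) (h₀ : y.1 0 = x.1 1)
    (h₁ : y.1 1 = x.1 2) (h₂ : y.1 2 = x.1 0) : t.faceMap (t.next d) y = t.faceMap d x :=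
  (Quot.sound (r := t.Glue) (Or.inl ⟨rfl, h₀, h₁, h₂⟩)).symm

theorem faceMap_next_sideCurve (d : D) (i j : Fin 3) (s : I) :
    t.faceMap (t.next d) (sideCurve i j s) = t.faceMap d (sideCurve (i + 1) (j + 1) s) := by
  refine t.faceMap_next d _ _ ?_ ?_ ?_ <;> rw [← sideCurve_add_one] <;> rfl

/-- The boundary of a face is the image of the boundary of a simplex, which is simply connected.
Besides reversal, this is the only relation between edge classes that the homology computation
needs. -/
theorem edgeClass_face (d : D) :
    t.edgeClass (t.nextEdge d) ≫ t.edgeClass (t.nextEdge (t.next d)) ≫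
      t.edgeClass (t.lastEdge d) = 𝟙 _ := by
  have h1 (s : I) : t.dartPoint (t.next d) s = t.faceMap d (sideCurve 1 2 s) := by
    rw [dartPoint_eq_faceMap, faceMap_next_sideCurve]; rfl
  have h2 (s : I) : t.dartPoint (t.next (t.next d)) s = t.faceMap d (sideCurve 2 0 s) := by
    rw [dartPoint_eq_faceMap, faceMap_next_sideCurve, faceMap_next_sideCurve]; rfl
  refine Path.Homotopic.Quotient.eq.2 (homotopic_refl_of_factor (t.faceMap d)
    (x := corner 0) (y := corner 1) (z := corner 2) ?_ ?_ ?_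
    (sideCurve 0 1) (sideCurve 1 2) (sideCurve 2 0) (t.dartPoint_eq_faceMap d) h1 h2)
  · exact (t.dartPoint_eq_faceMap d 0).trans (congrArg _ (sideCurve 0 1).source)
  · exact (h1 0).trans (congrArg _ (sideCurve 1 2).source)
  · exact (h2 0).trans (congrArg _ (sideCurve 2 0).source)

/-! ### Contractible and separating cycles -/

/-- A free homotopy amounts to a conjugation, and a conjugate of the identity is the identity; so
contractibility can be tested with a fixed base point. -/
theorem isContractible_iff {v : t.Vertex} (c : t.Walk v v) :
    t.IsContractible c ↔ t.walkClass c = 𝟙 _ := by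
  refine ⟨fun ⟨x, h⟩ => ?_, fun h => ⟨_, (Path.Homotopic.Quotient.exact h).freelyHomotopic⟩⟩
  obtain ⟨δ, h⟩ := h.exists_conj
  have h' : FundamentalGroupoid.fromPath (.mk (Path.refl x)) = 𝟙 _ := rfl
  rw [h', Category.id_comp, IsIso.hom_inv_id] at h
  exact h

theorem nonempty_walk_of_mem_closure {g : Equiv.Perm D}
    (hg : g ∈ Subgroup.closure {t.next, t.rev}) :
    ∀ d, Nonempty (t.Walk (t.src d) (t.src (g d))) := by
  induction hg using Subgroup.closure_induction with
  | mem g hg =>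
    intro d
    rcases hg with rfl | rfl
    · exact ⟨(t.nextEdge d).toPath⟩
    · exact ⟨Quiver.Hom.toPath ⟨d, rfl, rfl⟩⟩
  | one => exact fun d => ⟨Quiver.Path.nil⟩
  | mul f g _ _ hf hg =>
    intro d
    exact ⟨(hg d).some.comp (hf (g d)).some⟩
  | inv f _ hf =>
    intro d
    have h := (hf (f⁻¹ d)).some.reverse
    rw [show f (f⁻¹ d) = d from f.apply_symm_apply d] at h
    exact ⟨h⟩

theorem nonempty_walk (u v : t.Vertex) : Nonempty (t.Walk u v) := by
  obtain ⟨d, rfl⟩ := Quotient.exists_rep u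
  obtain ⟨e, rfl⟩ := Quotient.exists_rep v
  obtain ⟨g, hg, rfl⟩ := t.connected d e
  exact t.nonempty_walk_of_mem_closure hg d

/-- A base vertex. -/
def base : t.Vertex := t.src t.root

/-- A choice of a path from the base vertex to each vertex. -/
def spoke (v : t.Vertex) : t.pt t.base ⟶ t.pt v := t.walkClass (t.nonempty_walk t.base v).some

/-- The first homology group of the surface. -/
abbrev H₁ : Type u := Abelianization (FundamentalGroup t.Surface (t.vertexPoint t.base))

/-- The homology class of a path between two vertices, closed up by means of the chosen paths from
the base vertex. -/
def homology {u v : t.Vertex} (f : t.pt u ⟶ t.pt v) : t.H₁ :=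
  Abelianization.of (FundamentalGroup.fromArrow (t.spoke u ≫ f ≫ inv (t.spoke v)))

@[simp]
theorem homology_id (u : t.Vertex) : t.homology (𝟙 (t.pt u)) = 1 := by
  rw [homology, Category.id_comp, IsIso.hom_inv_id]
  exact map_one _

@[simp]
theorem homology_comp {u v w : t.Vertex} (f : t.pt u ⟶ t.pt v) (g : t.pt v ⟶ t.pt w) :
    t.homology (f ≫ g) = t.homology f * t.homology g := by
  rw [mul_comm, homology, homology, homology, ← map_mul]
  refine congrArg _ ?_
  rw [FundamentalGroup.fromArrow, End.mul_def]
  simp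

@[simp]
theorem homology_inv {u v : t.Vertex} (f : t.pt u ⟶ t.pt v) :
    t.homology (inv f) = (t.homology f)⁻¹ := by
  rw [eq_inv_iff_mul_eq_one, ← homology_comp, IsIso.inv_hom_id, homology_id]

/-- Conjugation by the spoke to `v` identifies the fundamental groups at `v` and at the base vertex,
hence their abelianizations. Classes of cycles at different vertices can then be compared in one
group. -/
theorem isSeparating_iff {v : t.Vertex} (c : t.Walk v v) :
    t.IsSeparating c ↔ t.homology (t.walkClass c) = 1 := by
  let e := (asIso (t.spoke v)).symm.conj.abelianizationCongr
  have he : e (homologyClass (t.curve c)) = t.homology (t.walkClass c) := by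
    rw [homologyClass, homology]
    simp only [e, abelianizationCongr_of]
    congr 1
  rw [IsSeparating, ← he, map_eq_one_iff e e.injective]

theorem Homotopic.homology_eq {u v : t.Vertex} {c : t.Walk u u} {c' : t.Walk v v}
    (h : t.Homotopic c c') : t.homology (t.walkClass c) = t.homology (t.walkClass c') := by
  obtain ⟨δ, h⟩ := FreelyHomotopic.exists_conj h
  have h' : t.walkClass c = δ ≫ t.walkClass c' ≫ inv δ := h
  rw [h', homology_comp, homology_comp, homology_inv, mul_left_comm, mul_inv_cancel, mul_one]

end Triangulation

/-! ### Torsion in the first homology group -/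

/-- The conditions on `τ` make every orbit have exactly three elements, so the sum splits into
vanishing triples. In the application the orbits are the faces. -/
theorem Finset.sum_eq_zero_of_order_three {α A : Type*} [Fintype α] [AddCommMonoid A]
    (τ : Equiv.Perm α) (hτ : ∀ a, τ (τ (τ a)) = a) (hne : ∀ a, τ a ≠ a) (F : α → A)
    (hF : ∀ a, F a + F (τ a) + F (τ (τ a)) = 0) : ∑ a, F a = 0 := by
  classical
  let R : Setoid α :=
    { r a b := a = b ∨ a = τ b ∨ a = τ (τ b)
      iseqv :=
        { refl a := Or.inl rfl
          symm := by rintro a b (rfl | rfl | rfl) <;> simp [hτ]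
          trans := by rintro a b c (rfl | rfl | rfl) (rfl | rfl | rfl) <;> simp [hτ] } }
  refine Finset.sum_cancels_of_partition_cancels R fun a _ => ?_
  have h : (Finset.univ.filter fun b => R b a) = {a, τ a, τ (τ a)} := by
    ext b
    simp only [Finset.mem_filter_univ, Finset.mem_insert, Finset.mem_singleton]
    rfl
  rw [h, Finset.sum_insert, Finset.sum_pair, ← add_assoc, hF]
  · exact (hne _).symm
  · have h2 : a ≠ τ (τ a) := fun h2 => hne a (by conv_lhs => rw [h2, hτ])
    simp [(hne a).symm, h2]

namespace Triangulation

variable {D : Type u} (t : Triangulation D)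

theorem darts_cons {u v w : t.Vertex} (p : t.Walk u v) (e : v ⟶ w) :
    t.darts (p.cons e) = t.darts p ++ [e.1] := rfl

@[simp]
theorem darts_toPath {u v : t.Vertex} (e : u ⟶ v) : t.darts e.toPath = [e.1] := rfl

@[simp]
theorem darts_comp {u v w : t.Vertex} (p : t.Walk u v) (q : t.Walk v w) :
    t.darts (p.comp q) = t.darts p ++ t.darts q := by
  induction q with
  | nil => simp [darts]
  | cons q e ih => simp [darts, ih]

@[simp]
theorem darts_reverse {u v : t.Vertex} (p : t.Walk u v) :
    t.darts p.reverse = (t.darts p).reverse.map t.rev := by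
  induction p with
  | nil => rfl
  | cons q e ih =>
    rw [Quiver.Path.reverse, darts_comp, ih]
    simp [darts]
    rfl

/-! ### Integral cocycles and winding numbers -/

section Winding

variable {φ : D → ℤ} (hrev : ∀ d, φ (t.rev d) = -φ d)
  (hface : ∀ d, φ d + φ (t.next d) + φ (t.next (t.next d)) = 0)

/-- The map to the circle given by an integral cocycle: it is affine on each face, sends the
vertices to `0` and winds `φ d` times around the circle along the dart `d`. -/
def circleMap : C(t.Surface, AddCircle (1 : ℝ)) where
  toFun := Quot.lift (fun a : Σ _ : D, stdSimplex ℝ (Fin 3) =>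
      ((a.2.1 1 * φ a.1 + a.2.1 2 * (φ a.1 + φ (t.next a.1)) : ℝ) : AddCircle (1 : ℝ))) (by
    rintro ⟨d, x⟩ ⟨e, y⟩ h
    have hx : x.1 0 + x.1 1 + x.1 2 = 1 := by
      rw [← Fin.sum_univ_three]; exact x.2.2
    -- Passing from `d` to `next d`, or across the edge to `rev d`, lowers the real value by exactly
    -- `φ d`, which is invisible modulo 1.
    refine QuotientAddGroup.eq_iff_sub_mem.2 (AddSubgroup.mem_zmultiples_iff.2 ⟨φ d, ?_⟩)
    obtain ⟨rfl, h₀, h₁, h₂⟩ | ⟨rfl, h, h₀, h₁, h₂⟩ := h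
    · have h := congrArg (Int.cast (R := ℝ)) (hface d)
      push_cast at h
      dsimp only at h₀ h₁ h₂ ⊢
      rw [h₁, h₂, zsmul_eq_mul]
      linear_combination x.1 0 * h - φ d * hx
    · have h' := congrArg (Int.cast (R := ℝ)) (hrev d)
      push_cast at h'
      dsimp only at h h₀ h₁ h₂ ⊢
      rw [h₁, h₂, h, h', zsmul_eq_mul]
      linear_combination φ d * h - φ d * hx)
  continuous_toFun := by
    refine continuous_quot_lift _ (continuous_sigma fun d => ?_)
    have h (i : Fin 3) : Continuous fun x : stdSimplex ℝ (Fin 3) => x.1 i :=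
      (continuous_apply i).comp continuous_subtype_val
    have h' : Continuous fun x : stdSimplex ℝ (Fin 3) =>
        x.1 1 * (φ d : ℝ) + x.1 2 * (φ d + φ (t.next d)) :=
      ((h 1).mul continuous_const).add ((h 2).mul continuous_const)
    exact (AddCircle.continuous_mk' 1).comp h'

theorem circleMap_dartPoint (d : D) (s : I) :
    t.circleMap hrev hface (t.dartPoint d s) = ((s * φ d : ℝ) : AddCircle (1 : ℝ)) := by
  change ((_ : ℝ) : AddCircle (1 : ℝ)) = _
  simp [sidePoint]

theorem circleMap_vertexPoint (v : t.Vertex) : t.circleMap hrev hface (t.vertexPoint v) = 0 := by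
  obtain ⟨d, rfl⟩ := Quotient.exists_rep v
  refine (t.circleMap_dartPoint hrev hface d 0).trans ?_
  simp

/-- The image of a dart in the circle lifts to the affine path from `x` to `x + φ d`, and monodromy
can be read off any lift. -/
theorem monodromy_edgeClass {u v : t.Vertex} (e : u ⟶ v)
    (x : ((↑) : ℝ → AddCircle (1 : ℝ)) ⁻¹' {t.circleMap hrev hface (t.vertexPoint u)}) :
    ((AddCircle.isCoveringMap_coe (1 : ℝ)).monodromy
      (Path.Homotopic.Quotient.map (t.edgeClass e) (t.circleMap hrev hface)) x : ℝ) =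
      x + φ e.1 := by
  obtain ⟨d, rfl, rfl⟩ := e
  have hx : ((x : ℝ) : AddCircle (1 : ℝ)) = 0 :=
    (Set.mem_singleton_iff.1 x.2).trans (t.circleMap_vertexPoint hrev hface _)
  have hy : ((x + φ d : ℝ) : AddCircle (1 : ℝ)) ∈
      ({t.circleMap hrev hface (t.vertexPoint (t.tgt d))} : Set _) := by
    rw [circleMap_vertexPoint, Set.mem_singleton_iff, AddCircle.coe_add, hx, zero_add]
    exact (QuotientAddGroup.eq_zero_iff _).2 (AddSubgroup.mem_zmultiples_iff.2 ⟨φ d, by simp⟩)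
  let Γ : Path (x : ℝ) (⟨x + φ d, hy⟩ : ((↑) : ℝ → AddCircle (1 : ℝ)) ⁻¹'
      {t.circleMap hrev hface (t.vertexPoint (t.tgt d))}) :=
    { toFun s := x + s * φ d
      continuous_toFun := by fun_prop
      source' := by simp
      target' := by simp }
  rw [(AddCircle.isCoveringMap_coe (1 : ℝ)).monodromy_eq_of_map_eq (Path.Homotopic.Quotient.mk Γ)]
  refine congrArg Path.Homotopic.Quotient.mk (Path.ext (funext fun s => ?_))
  refine Eq.trans ?_ (t.circleMap_dartPoint hrev hface d s).symm
  change ((x + s * φ d : ℝ) : AddCircle (1 : ℝ)) = _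
  rw [AddCircle.coe_add, hx, zero_add]

theorem monodromy_walkClass {u v : t.Vertex} (p : t.Walk u v)
    (x : ((↑) : ℝ → AddCircle (1 : ℝ)) ⁻¹' {t.circleMap hrev hface (t.vertexPoint u)}) :
    ((AddCircle.isCoveringMap_coe (1 : ℝ)).monodromy
      (Path.Homotopic.Quotient.map (t.walkClass p) (t.circleMap hrev hface)) x : ℝ) =
      x + ((t.darts p).map φ).sum := by
  induction p with
  | nil =>
    have h : Path.Homotopic.Quotient.map (t.walkClass Quiver.Path.nil) (t.circleMap hrev hface) =
      .refl (t.circleMap hrev hface (t.vertexPoint u)) := rfl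
    rw [h, IsCoveringMap.monodromy_refl]
    simp [darts]
  | cons p e ih =>
    have h : Path.Homotopic.Quotient.map (t.walkClass (p.cons e)) (t.circleMap hrev hface) =
      (Path.Homotopic.Quotient.map (t.walkClass p) (t.circleMap hrev hface)).trans
        (Path.Homotopic.Quotient.map (t.edgeClass e) (t.circleMap hrev hface)) :=
      (FundamentalGroupoid.map (t.circleMap hrev hface)).map_comp (t.walkClass p) (t.edgeClass e)
    rw [h, IsCoveringMap.monodromy_trans_apply, monodromy_edgeClass, ih, darts_cons]
    simp [add_assoc]

/-- Monodromy of the covering of the circle by the line gives a homomorphism from the fundamental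
group to an infinite cyclic group. It factors through homology and kills torsion, while on a cycle
it returns the sum of `φ` over the darts. -/
theorem sum_map_darts_eq_zero (hrev : ∀ d, φ (t.rev d) = -φ d)
    (hface : ∀ d, φ d + φ (t.next d) + φ (t.next (t.next d)) = 0)
    {v : t.Vertex} (c : t.Walk v v) {k : ℤ} (hk : k ≠ 0)
    (h : t.homology (t.walkClass c) ^ k = 1) : ((t.darts c).map φ).sum = 0 := by
  let s := (t.nonempty_walk t.base v).some
  let x : ((↑) : ℝ → AddCircle (1 : ℝ)) ⁻¹' {t.circleMap hrev hface (t.vertexPoint t.base)} :=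
    ⟨0, by rw [circleMap_vertexPoint]; rfl⟩
  let Θ := ((AddCircle.isAddQuotientCoveringMap_coe (1 : ℝ)).fundamentalGroupToMulOpposite x).comp
    (FundamentalGroup.map (t.circleMap hrev hface) (t.vertexPoint t.base))
  have hc : t.homology (t.walkClass c) =
      Abelianization.of (FundamentalGroup.fromArrow (t.walkClass (s.comp (c.comp s.reverse)))) := by
    simp only [walkClass_comp, walkClass_reverse]
    rfl
  have h1 := congrArg (Abelianization.lift Θ) h
  rw [hc, map_zpow, Abelianization.lift_apply_of, map_one] at h1
  have h2 := t.monodromy_walkClass hrev hface (s.comp (c.comp s.reverse)) x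
  have h3 := (AddCircle.isAddQuotientCoveringMap_coe (1 : ℝ)).unop_fundamentalGroupToMulOpposite_smul
    (e := x) (γ := FundamentalGroup.map (t.circleMap hrev hface) (t.vertexPoint t.base)
      (FundamentalGroup.fromArrow (t.walkClass (s.comp (c.comp s.reverse)))))
  have h4 := h3.trans h2
  change Θ _ ^ k = 1 at h1
  change ((Multiplicative.toAdd (MulOpposite.unop (Θ (FundamentalGroup.fromArrow
    (t.walkClass (s.comp (c.comp s.reverse)))))) : AddSubgroup.zmultiples (1 : ℝ)) : ℝ) + 0 =
      0 + _ at h4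
  generalize Θ (FundamentalGroup.fromArrow (t.walkClass (s.comp (c.comp s.reverse)))) = g at h1 h4
  have h5 : k • (Multiplicative.toAdd (MulOpposite.unop g)) = 0 := congrArg
    (fun g => Multiplicative.toAdd (MulOpposite.unop g)) h1
  rw [smul_eq_zero_iff_right hk] at h5
  rw [h5] at h4
  -- The path from the base vertex is run once in each direction, so its contribution cancels.
  have h6 (l : List D) : ((l.reverse.map t.rev).map φ).sum = -(l.map φ).sum := by
    induction l with
    | nil => rfl
    | cons d l ih =>
      simp only [List.map_reverse, List.sum_reverse, List.map_cons, List.sum_cons, hrev] at ih ⊢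
      rw [ih, neg_add]
  rw [darts_comp, darts_comp, darts_reverse, List.map_append, List.map_append, List.sum_append,
    List.sum_append, h6,
    show ∀ a b : ℤ, a + (b + -a) = b from fun a b => by ring] at h4
  rw [add_zero, zero_add, ZeroMemClass.coe_zero] at h4
  exact_mod_cast h4.symm

end Winding

/-! ### Chains modulo boundaries -/

/-- The number of times a walk runs along each dart. -/
def chain {u v : t.Vertex} (p : t.Walk u v) : D →₀ ℤ :=
  ((t.darts p).map fun d => Finsupp.single d 1).sum

/-- The functions on darts that are constant on faces. -/
def faceInvariant : Submodule ℤ (D →₀ ℤ) where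
  carrier := {f | ∀ d, f (t.next d) = f d}
  add_mem' hf hg d := by simp [hf d, hg d]
  zero_mem' _ := rfl
  smul_mem' k f hf d := by simp [hf d]

/-- The functions on darts that are invariant under reversal. -/
def revInvariant : Submodule ℤ (D →₀ ℤ) where
  carrier := {f | ∀ d, f (t.rev d) = f d}
  add_mem' hf hg d := by simp [hf d, hg d]
  zero_mem' _ := rfl
  smul_mem' k f hf d := by simp [hf d]

/-- The functions on darts whose antisymmetrization is the boundary of a sum of faces. -/
def boundaries : Submodule ℤ (D →₀ ℤ) := t.faceInvariant ⊔ t.revInvariant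

theorem eq_of_invariant {A : Type*} {f : D → A} (h₁ : ∀ d, f (t.next d) = f d)
    (h₂ : ∀ d, f (t.rev d) = f d) (d e : D) : f d = f e := by
  obtain ⟨g, hg, rfl⟩ := t.connected d e
  symm
  induction hg using Subgroup.closure_induction generalizing d with
  | mem g hg =>
    rcases hg with rfl | rfl
    · exact h₁ d
    · exact h₂ d
  | one => rfl
  | mul f g _ _ hf hg => exact (hf (g d)).trans (hg d)
  | inv g _ hg => exact (hg (g⁻¹ d)).symm.trans (congrArg f (g.apply_symm_apply d))

/-- If `k • n = g + m`, comparing `d` with `rev d` shows that `g` does not change modulo `k` across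
an edge; by connectedness its remainder modulo `k` is a global constant. Replacing `g` by its
quotient by `k` costs only this constant, which the reversal-invariant part absorbs. The coherent
orientation of the faces matters: the coefficients on the two sides of an edge agree modulo `k`, and
not merely up to sign. -/
theorem mem_boundaries_of_smul_mem [Finite D] {n : D →₀ ℤ} {k : ℤ} (hk : k ≠ 0)
    (h : k • n ∈ t.boundaries) : n ∈ t.boundaries := by
  have := Fintype.ofFinite D
  obtain ⟨g, hg, m, hm, h⟩ := Submodule.mem_sup.1 h
  have h (d : D) : g d + m d = k * n d := by rw [← Finsupp.add_apply, h]; simp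
  have hg (d : D) : g (t.next d) = g d := hg d
  have hm (d : D) : m (t.rev d) = m d := hm d
  have hmod (d : D) : g d % k = g t.root % k := by
    refine t.eq_of_invariant (f := fun d => g d % k) (fun d => by simp only [hg]) (fun d => ?_) _ _
    have h3 : g (t.rev d) = g d + k * (n (t.rev d) - n d) := by
      linear_combination h (t.rev d) - h d - hm d
    simp only [h3, Int.add_mul_emod_self_left]
  let g' : D →₀ ℤ := Finsupp.equivFunOnFinite.symm fun d => g d / k
  refine Submodule.mem_sup.2 ⟨g', fun d => ?_, n - g', fun d => ?_, by abel⟩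
  · simp [g', hg]
  · refine mul_left_cancel₀ hk ?_
    have h3 (d : D) : k * (n - g') d = m d + g t.root % k := by
      have h4 : k * g' d = g d - g d % k := by
        have := Int.mul_ediv_add_emod (g d) k
        simp only [g', Finsupp.equivFunOnFinite_symm_apply_apply]
        linarith
      rw [Finsupp.sub_apply, mul_sub, h4, hmod, ← h]
      ring
    rw [h3, h3, hm]

theorem single_add_single_rev_mem (d : D) :
    Finsupp.single d 1 + Finsupp.single (t.rev d) 1 ∈ t.boundaries := by
  refine Submodule.mem_sup_right fun e => ?_
  have h1 : (d = t.rev e) ↔ (t.rev d = e) := by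
    constructor <;> rintro rfl <;> rw [t.rev_rev]
  classical
  simp only [Finsupp.add_apply, Finsupp.single_apply, h1, EmbeddingLike.apply_eq_iff_eq]
  exact add_comm _ _

theorem single_add_single_next_mem (d : D) : Finsupp.single d 1 + Finsupp.single (t.next d) 1 +
    Finsupp.single (t.next (t.next d)) 1 ∈ t.boundaries := by
  refine Submodule.mem_sup_left fun e => ?_
  have h1 : (d = t.next e) ↔ (t.next (t.next d) = e) := by
    constructor <;> rintro rfl <;> simp only [t.next_next_next]
  classical
  simp only [Finsupp.add_apply, Finsupp.single_apply, h1, EmbeddingLike.apply_eq_iff_eq]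
  ring

/-- Chains modulo boundaries form a finitely generated torsion-free module over `ℤ`, so linear forms
separate its points. Each linear form is an integral cocycle, to which `sum_map_darts_eq_zero`
applies. -/
theorem chain_mem_boundaries [Finite D] {v : t.Vertex} (c : t.Walk v v) {k : ℤ} (hk : k ≠ 0)
    (h : t.homology (t.walkClass c) ^ k = 1) : t.chain c ∈ t.boundaries := by
  have : Module.IsTorsionFree ℤ ((D →₀ ℤ) ⧸ t.boundaries) := by
    refine Module.IsTorsionFree.of_smul_eq_zero fun k x hx => ?_
    obtain ⟨n, rfl⟩ := Submodule.Quotient.mk_surjective _ x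
    rw [or_iff_not_imp_left]
    intro hk
    rw [← Submodule.Quotient.mk_smul, Submodule.Quotient.mk_eq_zero] at hx
    exact (Submodule.Quotient.mk_eq_zero _).2 (t.mem_boundaries_of_smul_mem hk hx)
  rw [← Submodule.Quotient.mk_eq_zero, ← Module.forall_dual_apply_eq_zero_iff ℤ]
  intro l
  have hl {a : D →₀ ℤ} (ha : a ∈ t.boundaries) : l (Submodule.Quotient.mk a) = 0 := by
    rw [(Submodule.Quotient.mk_eq_zero _).2 ha, map_zero]
  have h1 := t.sum_map_darts_eq_zero
    (φ := fun d => l (Submodule.Quotient.mk (Finsupp.single d 1)))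
    (fun d => by
      have := hl (t.single_add_single_rev_mem d)
      rw [Submodule.Quotient.mk_add, map_add] at this
      linarith)
    (fun d => by
      have := hl (t.single_add_single_next_mem d)
      rwa [Submodule.Quotient.mk_add, Submodule.Quotient.mk_add, map_add, map_add] at this) c hk h
  rw [chain]
  change (l.comp t.boundaries.mkQ) _ = 0
  rw [map_list_sum, List.map_map]
  exact h1

/-- The homology class of a dart, closed up by means of the chosen paths from the base vertex. -/
def dartHomology (d : D) : t.H₁ := t.homology (t.edgeClass (⟨d, rfl, rfl⟩ : t.src d ⟶ t.tgt d))

theorem homology_edgeClass {u v : t.Vertex} (e : u ⟶ v) :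
    t.homology (t.edgeClass e) = t.dartHomology e.1 := by
  obtain ⟨d, rfl, rfl⟩ := e
  rfl

theorem dartHomology_rev (d : D) : t.dartHomology (t.rev d) = (t.dartHomology d)⁻¹ := by
  rw [dartHomology, dartHomology, ← homology_inv, ← edgeClass_reverse, homology_edgeClass,
    homology_edgeClass]
  rfl

theorem dartHomology_face (d : D) :
    t.dartHomology d * t.dartHomology (t.next d) * t.dartHomology (t.next (t.next d)) = 1 := by
  have h := congrArg t.homology (t.edgeClass_face d)
  rw [homology_comp, homology_comp, homology_id, ← mul_assoc] at h
  rwa [homology_edgeClass, homology_edgeClass, homology_edgeClass] at h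

/-- The homology class of a chain. -/
def chainHomology : (D →₀ ℤ) →+ Additive t.H₁ :=
  Finsupp.liftAddHom fun d =>
    zmultiplesHom _ (Additive.ofMul (t.dartHomology d))

theorem chainHomology_chain {u v : t.Vertex} (p : t.Walk u v) :
    t.chainHomology (t.chain p) = Additive.ofMul (t.homology (t.walkClass p)) := by
  induction p with
  | nil => simp [chain, darts]
  | cons p e ih =>
    have h : t.chain (p.cons e) = t.chain p + Finsupp.single e.1 1 := by
      simp [chain, darts_cons]
    rw [h, map_add, ih, walkClass_cons, homology_comp, ofMul_mul, homology_edgeClass]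
    simp [chainHomology]

/-- The part that is constant on faces contributes products around faces, which are trivial; the
reversal-invariant part cancels in pairs `d`, `rev d`. -/
theorem chainHomology_eq_zero [Finite D] {n : D →₀ ℤ} (h : n ∈ t.boundaries) :
    t.chainHomology n = 0 := by
  have := Fintype.ofFinite D
  obtain ⟨g, hg, m, hm, rfl⟩ := Submodule.mem_sup.1 h
  have hg (d : D) : g (t.next d) = g d := hg d
  have hm (d : D) : m (t.rev d) = m d := hm d
  have hs (f : D →₀ ℤ) :
    t.chainHomology f = ∑ d, f d • Additive.ofMul (t.dartHomology d) := by
    rw [chainHomology, Finsupp.liftAddHom_apply, Finsupp.sum_fintype _ _ fun d => map_zero _]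
    simp
  rw [map_add, hs, hs, Finset.sum_eq_zero_of_order_three t.next t.next_next_next t.next_ne,
    zero_add]
  · refine Finset.sum_involution (fun d _ => t.rev d) (fun d _ => ?_) (fun d _ _ => t.rev_ne d)
      (fun d _ => Finset.mem_univ _) (fun d _ => t.rev_rev d)
    rw [hm, ← smul_add, dartHomology_rev, ofMul_inv, add_neg_cancel, smul_zero]
  · intro d
    rw [hg (t.next d), hg, ← smul_add, ← smul_add, ← ofMul_mul, ← ofMul_mul, dartHomology_face,
      ofMul_one, smul_zero]

/-- The homology classes of the cycles have no torsion. -/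
theorem homology_eq_one_of_zpow_eq_one [Finite D] {v : t.Vertex} (c : t.Walk v v) {k : ℤ}
    (hk : k ≠ 0) (h : t.homology (t.walkClass c) ^ k = 1) : t.homology (t.walkClass c) = 1 := by
  have h1 := t.chainHomology_eq_zero (t.chain_mem_boundaries c hk h)
  rwa [chainHomology_chain, ofMul_eq_zero] at h1

end Triangulation

/-! ### Paths in quivers -/

namespace Quiver.Path

variable {V : Type*} [Quiver V]

theorem vertices_eq_cons {u v : V} (p : Path u v) : p.vertices = u :: p.vertices.tail := by
  have h := p.vertices_head_eq
  conv_lhs => rw [← List.cons_head_tail p.vertices_ne_nil, h]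

theorem tail_vertices_comp {u v w : V} (p : Path u v) (q : Path v w) :
    (p.comp q).vertices.tail = p.vertices.tail ++ q.vertices.tail := by
  have h : (p.comp q).vertices = p.vertices ++ q.vertices.tail := by
    conv_lhs => rw [vertices_comp, q.vertices_eq_cons, ← List.singleton_append, ← List.append_assoc,
      p.dropLast_append_end_eq]
  rw [h, List.tail_append_of_ne_nil p.vertices_ne_nil]

theorem dropLast_vertices_comp {u v w : V} (p : Path u v) (q : Path v w) :
    (p.comp q).vertices.dropLast = p.vertices.dropLast ++ q.vertices.dropLast := by
  rw [vertices_comp, List.dropLast_append_of_ne_nil q.vertices_ne_nil]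

theorem mem_dropLast_or_eq {u v x : V} {p : Path u v} (hx : x ∈ p.vertices) :
    x ∈ p.vertices.dropLast ∨ x = v := by
  rwa [← p.dropLast_append_end_eq, List.mem_append, List.mem_singleton] at hx

theorem mem_vertices_comp {u v w : V} (p : Path u v) (q : Path v w) (x : V) :
    x ∈ (p.comp q).vertices ↔ x ∈ p.vertices ∨ x ∈ q.vertices := by
  rw [vertices_comp, List.mem_append]
  refine ⟨Or.imp (fun h => List.dropLast_subset _ h) id, ?_⟩
  rintro (h | h)
  · rcases mem_dropLast_or_eq h with h | rfl
    exacts [Or.inl h, Or.inr q.start_mem_vertices]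
  · exact Or.inr h

theorem end_mem_tail_vertices {u v : V} {p : Path u v} (hp : 0 < p.length) :
    v ∈ p.vertices.tail := by
  cases p with
  | nil => simp at hp
  | cons p e =>
    rw [vertices_cons, List.concat_eq_append, List.tail_append_of_ne_nil p.vertices_ne_nil]
    simp

theorem start_mem_dropLast_vertices {u v : V} {p : Path u v} (hp : 0 < p.length) :
    u ∈ p.vertices.dropLast := by
  cases p with
  | nil => simp at hp
  | cons p e => simp [start_mem_vertices]

theorem length_pos_of_ne {u v : V} (p : Path u v) (h : u ≠ v) : 0 < p.length :=
  Nat.pos_of_ne_zero fun hp => h (eq_of_length_zero p hp)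

theorem tail_vertices_perm_dropLast {v : V} (c : Path v v) :
    c.vertices.tail.Perm c.vertices.dropLast := by
  have h : (v :: c.vertices.tail).Perm (c.vertices.dropLast ++ [v]) := by
    rw [← c.vertices_eq_cons, c.dropLast_append_end_eq]
  exact (List.perm_cons v).1 (h.trans (List.perm_append_singleton _ _))

@[simp]
theorem vertices_reverse [HasReverse V] {u v : V} (p : Path u v) :
    p.reverse.vertices = p.vertices.reverse := by
  induction p with
  | nil => rfl
  | cons p e ih => simp [reverse, ih]

@[simp]
theorem length_reverse [HasReverse V] {u v : V} (p : Path u v) :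
    p.reverse.length = p.length := by
  induction p with
  | nil => rfl
  | cons p e ih => simp [reverse, ih, add_comm]

theorem exists_eq_toPath_comp {u v : V} {p : Path u v} (hp : 0 < p.length) :
    ∃ (w : V) (e : u ⟶ w) (q : Path w v), p = e.toPath.comp q := by
  obtain ⟨w, e, q, -, h⟩ := p.eq_toPath_comp_of_length_eq_succ (n := p.length - 1) (by omega)
  exact ⟨w, e, q, h⟩

/-- A path that visits a vertex twice starts with a simple path followed by a simple cycle. -/
theorem exists_lasso {u v : V} (p : Path u v) (hp : ¬ p.vertices.Nodup) :
    ∃ (w : V) (q : Path u w) (l : Path w w) (r : Path w v), p = q.comp (l.comp r) ∧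
      0 < l.length ∧ l.vertices.tail.Nodup ∧ q.vertices.Nodup ∧
      ∀ z ∈ q.vertices, z ∈ l.vertices → z = w := by
  induction p with
  | nil => simp at hp
  | @cons v' v p e ih =>
    -- In the shortest prefix with a repeated vertex, only the last vertex has been visited before.
    -- The loop `l` starts at that earlier visit.
    by_cases h : p.vertices.Nodup
    · have hv : v ∈ p.vertices := by
        by_contra hv
        refine hp ?_
        rw [vertices_cons, List.concat_eq_append]
        exact List.nodup_append'.2 ⟨h, by simp, by simpa using hv⟩
      obtain ⟨q, s, rfl⟩ := p.exists_eq_comp_of_mem_vertices hv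
      have h1 := h
      rw [vertices_comp, List.nodup_append'] at h1
      have hs : (v :: s.vertices.tail).Nodup := s.vertices_eq_cons ▸ h1.2.1
      refine ⟨v, q, s.cons e, nil, rfl, by simp, ?_, ?_, ?_⟩
      · rw [vertices_cons, List.concat_eq_append, List.tail_append_of_ne_nil s.vertices_ne_nil]
        exact ((List.perm_append_singleton _ _).nodup_iff).2 hs
      · rw [← q.dropLast_append_end_eq]
        exact List.nodup_append'.2 ⟨h1.1, by simp,
          by simpa using fun h2 => h1.2.2 h2 s.start_mem_vertices⟩
      · intro z hz hz'
        rw [← q.dropLast_append_end_eq, List.mem_append, List.mem_singleton] at hz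
        rcases hz with hz | hz
        · rw [mem_vertices_cons] at hz'
          exact hz'.elim (fun h2 => (h1.2.2 hz h2).elim) id
        · exact hz
    · obtain ⟨w, q, l, r, rfl, h'⟩ := ih h
      exact ⟨w, q, l, r.cons e, by simp, h'⟩

/-- A path that ends in `S` can be cut at its first vertex in `S`. -/
theorem exists_first_hit (S : Set V) {u v : V} (p : Path u v) (hv : v ∈ S) :
    ∃ z ∈ S, ∃ (q : Path u z) (r : Path z v), p = q.comp r ∧ ∀ x ∈ q.vertices.dropLast, x ∉ S := by
  suffices h : (∀ x ∈ p.vertices, x ∉ S) ∨ ∃ z ∈ S, ∃ (q : Path u z) (r : Path z v),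
      p = q.comp r ∧ ∀ x ∈ q.vertices.dropLast, x ∉ S from
    h.resolve_left fun h => h v p.end_mem_vertices hv
  clear hv
  induction p with
  | nil =>
    by_cases hu : u ∈ S
    · exact Or.inr ⟨u, hu, nil, nil, rfl, by simp⟩
    · exact Or.inl (by simpa using hu)
  | @cons v' v p e ih =>
    rcases ih with h | ⟨z, hz, q, r, rfl, h⟩
    · by_cases hv : v ∈ S
      · exact Or.inr ⟨v, hv, p.cons e, nil, rfl, by simpa using h⟩
      · refine Or.inl fun x hx => ?_
        rcases (mem_vertices_cons p e).1 hx with hx | rfl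
        exacts [h x hx, hv]
    · exact Or.inr ⟨z, hz, q, r.cons e, rfl, h⟩

end Quiver.Path

namespace Triangulation

variable {D : Type u} (t : Triangulation D)

/-! ### Simple cycles -/

section

variable {t}

theorem IsSimpleCycle.rotate {u v : t.Vertex} {p : t.Walk u v} {q : t.Walk v u}
    (h : t.IsSimpleCycle (p.comp q)) : t.IsSimpleCycle (q.comp p) := by
  refine ⟨?_, ?_⟩
  · have := h.1
    rw [Quiver.Path.length_comp] at this ⊢
    omega
  · have := h.2
    rw [Quiver.Path.tail_vertices_comp] at this ⊢
    exact List.nodup_append_comm.1 this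

theorem IsSimpleCycle.reverse {v : t.Vertex} {c : t.Walk v v} (h : t.IsSimpleCycle c) :
    t.IsSimpleCycle c.reverse := by
  refine ⟨by simpa using h.1, ?_⟩
  rw [Quiver.Path.vertices_reverse, List.tail_reverse, List.nodup_reverse,
    ← c.tail_vertices_perm_dropLast.nodup_iff]
  exact h.2

theorem IsSimpleCycle.isSimplePath_left {u v : t.Vertex} {p : t.Walk u v} {q : t.Walk v u}
    (h : t.IsSimpleCycle (p.comp q)) (hne : u ≠ v) : t.IsSimplePath p := by
  have h2 := h.2
  rw [Quiver.Path.tail_vertices_comp, List.nodup_append'] at h2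
  rw [IsSimplePath, p.vertices_eq_cons, List.nodup_cons]
  exact ⟨fun h3 => h2.2.2 h3 (Quiver.Path.end_mem_tail_vertices (q.length_pos_of_ne hne.symm)),
    h2.1⟩

theorem isSeparating_rotate {u v : t.Vertex} {p : t.Walk u v} {q : t.Walk v u} :
    t.IsSeparating (p.comp q) ↔ t.IsSeparating (q.comp p) := by
  rw [isSeparating_iff, isSeparating_iff, walkClass_comp, walkClass_comp, homology_comp,
    homology_comp, mul_comm]

theorem isSeparating_reverse {v : t.Vertex} {c : t.Walk v v} :
    t.IsSeparating c.reverse ↔ t.IsSeparating c := by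
  rw [isSeparating_iff, isSeparating_iff, walkClass_reverse, homology_inv, inv_eq_one]

theorem isContractible_rotate {u v : t.Vertex} {p : t.Walk u v} {q : t.Walk v u} :
    t.IsContractible (p.comp q) ↔ t.IsContractible (q.comp p) := by
  rw [isContractible_iff, isContractible_iff, walkClass_comp, walkClass_comp]
  constructor <;> intro h
  · rw [← IsIso.inv_eq_of_hom_inv_id h, IsIso.inv_hom_id]
  · rw [← IsIso.inv_eq_of_hom_inv_id h, IsIso.inv_hom_id]

theorem src_mem_dropLast_vertices {u v : t.Vertex} {p : t.Walk u v} {d : D} (hd : d ∈ t.darts p) :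
    t.src d ∈ p.vertices.dropLast := by
  induction p with
  | nil => simp [darts] at hd
  | cons p e ih =>
    rw [darts_cons, List.mem_append, List.mem_singleton] at hd
    simp only [Quiver.Path.vertices_cons, List.concat_eq_append, List.dropLast_concat]
    rcases hd with hd | rfl
    · exact List.dropLast_subset _ (ih hd)
    · rw [e.2.1]
      exact p.end_mem_vertices

theorem tgt_mem_tail_vertices {u v : t.Vertex} {p : t.Walk u v} {d : D} (hd : d ∈ t.darts p) :
    t.tgt d ∈ p.vertices.tail := by
  induction p with
  | nil => simp [darts] at hd
  | cons p e ih =>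
    rw [darts_cons, List.mem_append, List.mem_singleton] at hd
    rw [Quiver.Path.vertices_cons, List.concat_eq_append,
      List.tail_append_of_ne_nil p.vertices_ne_nil, List.mem_append]
    rcases hd with hd | rfl
    · exact Or.inl (ih hd)
    · exact Or.inr (by simp [e.2.2])

theorem ends_mem_vertices {u v : t.Vertex} {p : t.Walk u v} {d : D}
    (hd : d ∈ t.darts p ∨ t.rev d ∈ t.darts p) : t.src d ∈ p.vertices ∧ t.tgt d ∈ p.vertices := by
  rcases hd with hd | hd
  · exact ⟨List.dropLast_subset _ (src_mem_dropLast_vertices hd),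
      List.mem_of_mem_tail (tgt_mem_tail_vertices hd)⟩
  · have h := List.mem_of_mem_tail (tgt_mem_tail_vertices hd)
    rw [tgt, t.rev_rev] at h
    exact ⟨h, List.dropLast_subset _ (src_mem_dropLast_vertices hd)⟩

end

/-! ### Walks homotopic to walks along a cycle -/

/-- Given a choice `α` of a path from `w` to each vertex, the homotopy class `f`, once closed up, is
a power of the loop `A`. -/
def IsAlong {w : t.Vertex} (α : ∀ v, t.pt w ⟶ t.pt v) (A : End (t.pt w)) {u v : t.Vertex}
    (f : t.pt u ⟶ t.pt v) : Prop :=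
  (α u ≫ f ≫ inv (α v) : End (t.pt w)) ∈ Subgroup.zpowers A

section

variable {t} {w : t.Vertex} {α : ∀ v, t.pt w ⟶ t.pt v} {A : End (t.pt w)}

theorem IsAlong.id (u : t.Vertex) : t.IsAlong α A (𝟙 (t.pt u)) := by
  rw [IsAlong, Category.id_comp, IsIso.hom_inv_id]
  exact one_mem _

theorem IsAlong.comp {u v x : t.Vertex} {f : t.pt u ⟶ t.pt v} {g : t.pt v ⟶ t.pt x}
    (hf : t.IsAlong α A f) (hg : t.IsAlong α A g) : t.IsAlong α A (f ≫ g) := by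
  -- Multiplication in `End` is composition in the opposite order.
  have h := mul_mem hg hf
  rw [End.mul_def] at h
  simpa [IsAlong] using h

theorem IsAlong.inv {u v : t.Vertex} {f : t.pt u ⟶ t.pt v} (hf : t.IsAlong α A f) :
    t.IsAlong α A (inv f) := by
  let x : End (t.pt w) := α u ≫ f ≫ CategoryTheory.inv (α v)
  let y : End (t.pt w) := α v ≫ CategoryTheory.inv f ≫ CategoryTheory.inv (α u)
  have h : x * y = 1 := by
    rw [End.mul_def, End.one_def]
    simp [x, y]
  have h2 : y ∈ Subgroup.zpowers A := by
    rw [← inv_eq_of_mul_eq_one_right h]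
    exact inv_mem hf
  exact h2

theorem IsAlong.walk {u v : t.Vertex} (p : t.Walk u v)
    (h : ∀ (x y : t.Vertex) (e : x ⟶ y), e.1 ∈ t.darts p → t.IsAlong α A (t.edgeClass e)) :
    t.IsAlong α A (t.walkClass p) := by
  induction p with
  | nil => exact IsAlong.id _
  | cons p e ih =>
    refine (ih fun x y e' he => h x y e' ?_).comp (h _ _ e ?_) <;> simp [darts_cons]
    exact Or.inl he

end

/-- The spokes are the initial segments of `p`, which makes every edge of `p` trivial once closed
up. Since `p` is simple, each of its vertices receives a single segment; the spokes elsewhere are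
arbitrary. -/
theorem exists_spokes_path {w x : t.Vertex} (p : t.Walk w x) (hp : t.IsSimplePath p) :
    ∃ α : ∀ v, t.pt w ⟶ t.pt v, α w = 𝟙 _ ∧ α x = t.walkClass p ∧
      ∀ (u v : t.Vertex) (e : u ⟶ v), e.1 ∈ t.darts p → α u ≫ t.edgeClass e = α v := by
  classical
  induction p with
  | nil =>
    refine ⟨Function.update (fun v => t.walkClass (t.nonempty_walk w v).some) w (𝟙 _), ?_, ?_, ?_⟩
    · simp
    · simp
    · simp [darts]
  | @cons x y p e ih =>
    rw [IsSimplePath, Quiver.Path.vertices_cons, List.concat_eq_append, List.nodup_append'] at hp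
    obtain ⟨α, h₁, h₂, h₃⟩ := ih hp.1
    have hy (z : t.Vertex) (hz : z ∈ p.vertices) : z ≠ y := by
      rintro rfl
      exact hp.2.2 hz (by simp)
    refine ⟨Function.update α y (t.walkClass (p.cons e)), ?_, by simp, ?_⟩
    · rw [Function.update_of_ne (hy _ p.start_mem_vertices), h₁]
    · intro u v f hf
      rw [darts_cons, List.mem_append, List.mem_singleton] at hf
      rcases hf with hf | hf
      · have h := ends_mem_vertices (Or.inl hf)
        rw [f.2.1, f.2.2] at h
        rw [Function.update_of_ne (hy _ h.1), Function.update_of_ne (hy _ h.2)]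
        exact h₃ _ _ _ hf
      · obtain rfl : u = x := by rw [← f.2.1, hf, e.2.1]
        obtain rfl : v = y := by rw [← f.2.2, hf, e.2.2]
        obtain rfl : f = e := Subtype.ext hf
        rw [Function.update_of_ne (hy _ p.end_mem_vertices), Function.update_self, h₂,
          walkClass_cons]

/-- Open the cycle at its last edge and use initial segments as spokes: that edge closes up to the
whole loop, all the others to the identity. -/
theorem exists_spokes_cycle {w : t.Vertex} (a : t.Walk w w) (ha : t.IsSimpleCycle a) :
    ∃ α : ∀ v, t.pt w ⟶ t.pt v, α w = 𝟙 _ ∧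
      ∀ (u v : t.Vertex) (e : u ⟶ v), e.1 ∈ t.darts a →
        t.IsAlong α (t.walkClass a) (t.edgeClass e) := by
  obtain ⟨x, p, f, rfl⟩ := (Quiver.Path.length_ne_zero_iff_eq_cons a).1 ha.1.ne'
  have hp : t.IsSimplePath p := by
    have h := (Quiver.Path.tail_vertices_perm_dropLast _).nodup_iff.1 ha.2
    simpa only [Quiver.Path.vertices_cons, List.concat_eq_append, List.dropLast_concat,
      IsSimplePath] using h
  obtain ⟨α, h₁, h₂, h₃⟩ := t.exists_spokes_path p hp
  refine ⟨α, h₁, fun u v e he => ?_⟩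
  rw [darts_cons, List.mem_append, List.mem_singleton] at he
  rcases he with he | he
  · rw [IsAlong, ← Category.assoc, h₃ _ _ _ he, IsIso.hom_inv_id]
    exact one_mem _
  · obtain rfl : u = x := by rw [← e.2.1, he, f.2.1]
    obtain rfl : v = w := by rw [← e.2.2, he, f.2.2]
    obtain rfl : e = f := Subtype.ext he
    simp only [IsAlong, h₂, h₁, IsIso.inv_id, Category.comp_id]
    exact Subgroup.mem_zpowers (G := End _) _

end Triangulation

namespace Triangulation

variable {D : Type u} (t : Triangulation D)

/-! ### Finding eights -/

/-- The triangulation contains a thin eight or a fat eight of total length at most `L`. -/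
def HasEight (L : ℕ) : Prop :=
  ((∃ (u v x y : t.Vertex) (c₁ : t.Walk u u) (c₂ : t.Walk v v) (p : t.Walk x y),
      t.IsThinEight c₁ c₂ p ∧ c₁.length + c₂.length + p.length ≤ L) ∨
    (∃ (v : t.Vertex) (c₁ c₂ : t.Walk v v), t.MeetOnce c₁ c₂ ∧ ¬ t.CrossAtStart c₁ c₂ ∧
      c₁.length + c₂.length ≤ L)) ∨
  ((∃ (u w : t.Vertex) (c : t.Walk u u) (p : t.Walk u w),
      t.IsFatEight c p ∧ c.length + p.length ≤ L) ∨
    (∃ (v : t.Vertex) (c₁ c₂ : t.Walk v v), t.MeetOnce c₁ c₂ ∧ t.CrossAtStart c₁ c₂ ∧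
      c₁.length + c₂.length ≤ L))

variable {t}

/-- Crossing only decides whether the eight is fat or thin. Both are allowed, so the cyclic order at
the common vertex never has to be examined. -/
theorem MeetOnce.hasEight {v : t.Vertex} {c₁ c₂ : t.Walk v v} (h : t.MeetOnce c₁ c₂) {L : ℕ}
    (hL : c₁.length + c₂.length ≤ L) : t.HasEight L := by
  by_cases hc : t.CrossAtStart c₁ c₂
  · exact Or.inr (Or.inr ⟨v, c₁, c₂, h, hc, hL⟩)
  · exact Or.inl (Or.inr ⟨v, c₁, c₂, h, hc, hL⟩)

/-- If `c` were freely homotopic to both orientations of `l`, its homology class would equal its own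
inverse, hence be torsion, hence trivial. -/
theorem not_homotopic_or_not_homotopic_reverse [Finite D] {u v : t.Vertex} {c : t.Walk u u}
    (hc : ¬ t.IsSeparating c) (l : t.Walk v v) :
    ¬ t.Homotopic c l ∨ ¬ t.Homotopic c l.reverse := by
  by_contra! h
  have h1 := h.1.homology_eq
  have h2 := h.2.homology_eq
  rw [walkClass_reverse, homology_inv, ← h1] at h2
  refine hc ((t.isSeparating_iff c).2 (t.homology_eq_one_of_zpow_eq_one c two_ne_zero ?_))
  rw [zpow_two]
  nth_rw 1 [h2]
  exact inv_mul_cancel _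

theorem hasEight_of_disjoint [Finite D] {u v x : t.Vertex} {c : t.Walk u u} {l : t.Walk v v}
    {p : t.Walk x v} (hc : t.IsSimpleCycle c) (hl : t.IsSimpleCycle l) (hc' : ¬ t.IsSeparating c)
    (hl' : ¬ t.IsSeparating l) (hdisj : ∀ z ∈ c.vertices, z ∉ l.vertices) (hp : t.IsSimplePath p)
    (hx : x ∈ c.vertices) (hpx : ∀ z ∈ p.vertices, z ∈ c.vertices → z = x)
    (hpv : ∀ z ∈ p.vertices, z ∈ l.vertices → z = v) {L : ℕ}
    (hL : c.length + l.length + p.length ≤ L) : t.HasEight L := by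
  refine Or.inl (Or.inl ?_)
  rcases not_homotopic_or_not_homotopic_reverse hc' l with h | h
  · exact ⟨u, v, x, v, c, l, p, ⟨hc, hl, hc', hl', h, hdisj, hp, hx, l.start_mem_vertices, hpx,
      hpv⟩, hL⟩
  · refine ⟨u, v, x, v, c, l.reverse, p, ⟨hc, hl.reverse, hc', ?_, h, ?_, hp, hx,
      Quiver.Path.start_mem_vertices _, hpx, ?_⟩, by simpa using hL⟩
    · rwa [isSeparating_reverse]
    · simpa using hdisj
    · simpa using hpv

/-- The walk `e.toPath.comp p` is an excursion of `b`, from a vertex of `a` to the next visit to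
`a`. Sharing an edge with `a` forces it to be that edge. If `p` is simple, the excursion is either a
cycle meeting `a` once or a chord of `a`. If `p` repeats a vertex, it contains a lasso whose loop
avoids `a`, and this gives a thin eight. Every eight found is made of `a` and a portion of `b`,
whence the length bound. -/
theorem isAlong_of_not_hasEight [Finite D] {w : t.Vertex} {a b : t.Walk w w}
    (ha : t.IsSimpleCycle a) (ha' : ¬ t.IsSeparating a)
    (hb : ∀ (z : t.Vertex) (p : t.Walk w z) (l : t.Walk z z) (q : t.Walk z w),
      b = p.comp (l.comp q) → 0 < l.length → ¬ t.IsSeparating l)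
    (hE : ¬ t.HasEight (a.length + b.length)) {α : ∀ v, t.pt w ⟶ t.pt v}
    (hα : ∀ (u v : t.Vertex) (e : u ⟶ v), e.1 ∈ t.darts a →
      t.IsAlong α (t.walkClass a) (t.edgeClass e))
    {x y z : t.Vertex} (hx : x ∈ a.vertices) (hz : z ∈ a.vertices) (b₁ : t.Walk w x) (e : x ⟶ y)
    (p : t.Walk y z) (b₂ : t.Walk z w) (hbp : b = b₁.comp ((e.toPath.comp p).comp b₂))
    (hp : ∀ v ∈ p.vertices.dropLast, v ∉ a.vertices) :
    t.IsAlong α (t.walkClass a) (t.walkClass (e.toPath.comp p)) := by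
  have hα' {u v : t.Vertex} (s : t.Walk u v) (hs : ∀ d ∈ t.darts s, d ∈ t.darts a) :
      t.IsAlong α (t.walkClass a) (t.walkClass s) :=
    IsAlong.walk s fun _ _ e he => hα _ _ e (hs _ he)
  have hvert' {z : t.Vertex} (p : t.Walk y z) :
      (e.toPath.comp p).vertices = x :: p.vertices := by
    simp
  have hvert (v : t.Vertex) : v ∈ (e.toPath.comp p).vertices ↔ v = x ∨ v ∈ p.vertices := by
    rw [hvert', List.mem_cons]
  have hmem (v : t.Vertex) (hv : v ∈ p.vertices) (hv' : v ∈ a.vertices) : v = z :=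
    (Quiver.Path.mem_dropLast_or_eq hv).resolve_left fun h => hp v h hv'
  have hlen : (e.toPath.comp p).length = p.length + 1 := by
    rw [Quiver.Path.length_comp, Quiver.Path.length_toPath, add_comm]
  have hblen : b.length = b₁.length + (e.toPath.comp p).length + b₂.length := by
    rw [hbp, Quiver.Path.length_comp, Quiver.Path.length_comp (e.toPath.comp p), add_assoc]
  by_cases hshare : t.ShareEdge (e.toPath.comp p) a
  · obtain ⟨d, hd, hda⟩ := hshare
    have hends := ends_mem_vertices hda
    rw [darts_comp, darts_toPath, List.mem_append, List.mem_singleton] at hd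
    -- The darts of `p` start off `a`, so only the first dart of the excursion can be shared.
    have hd : d = e.1 := by
      refine hd.resolve_right fun hd => hp _ (src_mem_dropLast_vertices hd) hends.1
    subst hd
    rw [e.2.2] at hends
    have hp0 : p.length = 0 := by
      by_contra h
      exact hp y (Quiver.Path.start_mem_dropLast_vertices (Nat.pos_of_ne_zero h)) hends.2
    obtain rfl := Quiver.Path.eq_of_length_zero p hp0
    obtain rfl := Quiver.Path.eq_nil_of_length_zero p hp0
    rw [Quiver.Path.comp_nil, walkClass_toPath]
    rcases hda with hda | hda
    · exact hα _ _ e hda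
    · have h := (hα _ _ (Quiver.reverse e) hda).inv
      rwa [← edgeClass_reverse, Quiver.reverse_reverse] at h
  by_cases hnd : p.vertices.Nodup
  · obtain ⟨a₁, a₂, hsplit⟩ := a.exists_eq_comp_of_mem_vertices hx
    have hc : t.IsSimpleCycle (a₂.comp a₁) := (hsplit ▸ ha).rotate
    have hc' : ¬ t.IsSeparating (a₂.comp a₁) := by rwa [isSeparating_rotate, ← hsplit]
    have hcv (v : t.Vertex) : v ∈ (a₂.comp a₁).vertices ↔ v ∈ a.vertices := by
      rw [hsplit, Quiver.Path.mem_vertices_comp, Quiver.Path.mem_vertices_comp, or_comm]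
    have hcd (d : D) : d ∈ t.darts (a₂.comp a₁) ↔ d ∈ t.darts a := by
      rw [hsplit, darts_comp, darts_comp, List.mem_append, List.mem_append, or_comm]
    have hcl : (a₂.comp a₁).length = a.length := by
      rw [hsplit, Quiver.Path.length_comp, Quiver.Path.length_comp, add_comm]
    generalize a₂.comp a₁ = c at hc hc' hcv hcd hcl
    by_cases hxz : x = z
    · subst hxz
      refine (hE (MeetOnce.hasEight (c₁ := c) (c₂ := e.toPath.comp p) ?_ (by omega))).elim
      refine ⟨hc, ⟨by omega, ?_⟩, hc', hb x b₁ _ b₂ hbp (by omega), ?_, ?_⟩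
      · rwa [Quiver.Path.tail_vertices_comp, Quiver.Path.vertices_toPath_tail,
          List.singleton_append, ← p.vertices_eq_cons]
      · intro v hv hv'
        exact ((hvert v).1 hv').elim id fun h => hmem v h ((hcv v).1 hv)
      · rintro ⟨d, hd, hd'⟩
        rw [hcd] at hd
        rcases hd' with hd' | hd'
        · exact hshare ⟨d, hd', Or.inl hd⟩
        · exact hshare ⟨_, hd', Or.inr (by rwa [t.rev_rev])⟩
    · obtain ⟨q, s, rfl⟩ := c.exists_eq_comp_of_mem_vertices ((hcv z).2 hz)
      -- The two arcs of the cycle from `x` to `z` are `q` and `s.reverse`. If the excursion closed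
      -- up with either one is contractible, it is homotopic to that arc and hence runs along `a`.
      by_contra hnot
      refine hE (Or.inr (Or.inl ⟨x, z, q.comp s, e.toPath.comp p, ⟨hc, hc', ?_, (hcv z).2 hz, ?_,
        ?_, q, s.reverse, hc.isSimplePath_left hxz, ?_, by rw [Quiver.Path.reverse_reverse],
        fun h => hnot ?_, fun h => hnot ?_⟩, by omega⟩))
      · rw [IsSimplePath, hvert', List.nodup_cons]
        exact ⟨fun h => hxz (hmem x h hx), hnd⟩
      · intro v hv hv'
        exact ((hvert v).1 hv).imp id fun h => hmem v h ((hcv v).1 hv')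
      · rintro ⟨d, hd, hd'⟩
        rw [hcd, hcd] at hd'
        exact hshare ⟨d, hd, hd'⟩
      · have h := hc.rotate.isSimplePath_left (Ne.symm hxz)
        rw [IsSimplePath] at h ⊢
        rwa [Quiver.Path.vertices_reverse, List.nodup_reverse]
      · rw [isContractible_iff, Quiver.Path.reverse_reverse, t.walkClass_comp _ s] at h
        rw [IsIso.eq_inv_of_inv_hom_id h]
        exact (hα' s fun d hd => (hcd d).1 (by simp [hd])).inv
      · rw [isContractible_iff, walkClass_comp, walkClass_reverse, IsIso.comp_inv_eq,
          Category.id_comp] at h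
        rw [← h]
        exact hα' q fun d hd => (hcd d).1 (by simp [hd])
  · obtain ⟨y', q, l, r, rfl, hl₁, hl₂, hq, hql⟩ := p.exists_lasso hnd
    simp only [Quiver.Path.dropLast_vertices_comp, List.mem_append] at hp
    -- As `l` is nonempty, its base vertex `y'` occurs before the final position of the excursion,
    -- and so lies off `a`.
    have hy' : y' ∉ a.vertices :=
      hp y' (Or.inr (Or.inl (Quiver.Path.start_mem_dropLast_vertices hl₁)))
    have hq' (v : t.Vertex) (hv : v ∈ q.vertices) : v ∉ a.vertices := by
      rcases Quiver.Path.mem_dropLast_or_eq hv with h | rfl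
      exacts [hp v (Or.inl h), hy']
    have hl' (v : t.Vertex) (hv : v ∈ l.vertices) : v ∉ a.vertices := by
      rcases Quiver.Path.mem_dropLast_or_eq hv with h | rfl
      exacts [hp v (Or.inr (Or.inl h)), hy']
    refine (hE (hasEight_of_disjoint (c := a) (l := l) (p := e.toPath.comp q) ha ⟨hl₁, hl₂⟩ ha'
      (hb y' (b₁.comp (e.toPath.comp q)) l (r.comp b₂) ?_ hl₁) ?_ ?_ hx ?_ ?_ ?_)).elim
    · rw [hbp]
      simp only [Quiver.Path.comp_assoc]
    · exact fun v hv hv' => hl' v hv' hv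
    · rw [IsSimplePath, hvert', List.nodup_cons]
      exact ⟨fun h => hq' x h hx, hq⟩
    · intro v hv hva
      rw [hvert', List.mem_cons] at hv
      exact hv.resolve_right fun h => hq' v h hva
    · intro v hv hvl
      rw [hvert', List.mem_cons] at hv
      rcases hv with rfl | hv
      exacts [(hl' _ hvl hx).elim, hql v hv hvl]
    · simp only [Quiver.Path.length_comp, Quiver.Path.length_toPath] at hblen ⊢
      omega

theorem isAlong_of_suffix [Finite D] {w : t.Vertex} {a b : t.Walk w w}
    (ha : t.IsSimpleCycle a) (ha' : ¬ t.IsSeparating a)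
    (hb : ∀ (z : t.Vertex) (p : t.Walk w z) (l : t.Walk z z) (q : t.Walk z w),
      b = p.comp (l.comp q) → 0 < l.length → ¬ t.IsSeparating l)
    (hE : ¬ t.HasEight (a.length + b.length)) {α : ∀ v, t.pt w ⟶ t.pt v}
    (hα : ∀ (u v : t.Vertex) (e : u ⟶ v), e.1 ∈ t.darts a →
      t.IsAlong α (t.walkClass a) (t.edgeClass e)) (n : ℕ)
    {x : t.Vertex} (hx : x ∈ a.vertices) (b₁ : t.Walk w x) (s : t.Walk x w) (hs : s.length ≤ n)
    (hbs : b = b₁.comp s) : t.IsAlong α (t.walkClass a) (t.walkClass s) := by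
  induction n generalizing x with
  | zero =>
    have hs : s.length = 0 := by omega
    obtain rfl := Quiver.Path.eq_of_length_zero s hs
    obtain rfl := Quiver.Path.eq_nil_of_length_zero s hs
    exact IsAlong.id _
  | succ n ih =>
    rcases Nat.eq_zero_or_pos s.length with h0 | hpos
    · exact ih hx b₁ s (by omega) hbs
    -- The first edge is removed before looking for the next visit to `a`; otherwise `x` itself
    -- would be found.
    obtain ⟨y, e, s', rfl⟩ := Quiver.Path.exists_eq_toPath_comp hpos
    obtain ⟨z, hz, p, r, rfl, hp⟩ :=
      s'.exists_first_hit {v | v ∈ a.vertices} a.end_mem_vertices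
    have h1 := isAlong_of_not_hasEight ha ha' hb hE hα hx hz b₁ e p r (by simpa using hbs) hp
    have h2 := ih hz (b₁.comp (e.toPath.comp p)) r (by
      simp only [Quiver.Path.length_comp, Quiver.Path.length_toPath] at hs
      omega) (by simpa using hbs)
    have h3 := h1.comp h2
    rwa [← walkClass_comp, Quiver.Path.comp_assoc] at h3

theorem hasEight_of_minimal [Finite D] {w : t.Vertex} {a b : t.Walk w w} (ha : t.IsSimpleCycle a)
    (hb : 0 < b.length) (hnc : ¬ t.IsContractible (a.comp b)) (hsep : t.IsSeparating (a.comp b))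
    (hmin : ∀ (v : t.Vertex) (c : t.Walk v v), ¬ t.IsContractible c → t.IsSeparating c →
      a.length + b.length ≤ c.length) : t.HasEight (a.length + b.length) := by
  by_contra hE
  have ha0 := ha.1
  have hshort {v : t.Vertex} {c : t.Walk v v} (hc : t.IsSeparating c)
      (hl : c.length < a.length + b.length) : t.walkClass c = 𝟙 _ := by
    rw [← isContractible_iff]
    by_contra h
    exact absurd (hmin v c h hc) (by omega)
  rw [isContractible_iff, walkClass_comp] at hnc
  rw [isSeparating_iff, walkClass_comp] at hsep
  -- A separating `a` is shorter than `a · b`, hence contractible. Then `b` is separating and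
  -- shorter as well, so it is also contractible, and so is the product.
  have ha' : ¬ t.IsSeparating a := by
    intro h
    rw [hshort h (by omega), Category.id_comp] at hnc hsep
    exact hnc (hshort ((t.isSeparating_iff b).2 hsep) (by omega))
  -- A separating subloop of `b` is contractible by minimality, so deleting it gives a shorter cycle
  -- in the same class as `a · b`.
  have hb' (z : t.Vertex) (p : t.Walk w z) (l : t.Walk z z) (q : t.Walk z w)
      (h : b = p.comp (l.comp q)) (hl : 0 < l.length) : ¬ t.IsSeparating l := by
    intro hs
    have hblen : b.length = p.length + (l.length + q.length) := by
      rw [h, Quiver.Path.length_comp, Quiver.Path.length_comp]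
    have h1 : t.walkClass b = t.walkClass (p.comp q) := by
      rw [h, walkClass_comp, walkClass_comp, hshort hs (by omega), Category.id_comp, walkClass_comp]
    rw [h1, ← walkClass_comp] at hnc hsep
    refine hnc (hshort ((t.isSeparating_iff _).2 hsep) ?_)
    simp only [Quiver.Path.length_comp]
    omega
  obtain ⟨α, hα₁, hα⟩ := t.exists_spokes_cycle a ha
  have h := isAlong_of_suffix ha ha' hb' hE hα b.length a.start_mem_vertices Quiver.Path.nil b
    le_rfl (by simp)
  simp only [IsAlong, hα₁, IsIso.inv_id, Category.comp_id, Category.id_comp] at h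
  obtain ⟨k, hk⟩ := (Subgroup.mem_zpowers_iff (G := End (t.pt w))).1 h
  -- Composition in `End` is reversed, but the target is commutative, so this is still a
  -- homomorphism.
  let Z : End (t.pt w) →* t.H₁ :=
    { toFun f := t.homology f
      map_one' := t.homology_id w
      map_mul' f g := (t.homology_comp g f).trans (mul_comm _ _) }
  have hZ : t.homology (t.walkClass b) = t.homology (t.walkClass a) ^ k := by
    rw [← hk]
    exact map_zpow Z _ k
  rw [homology_comp, hZ, mul_self_zpow] at hsep
  have hk1 : k + 1 = 0 := by
    by_contra hk1
    exact ha' ((t.isSeparating_iff a).2 (t.homology_eq_one_of_zpow_eq_one a hk1 hsep))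
  obtain rfl : k = -1 := by omega
  rw [zpow_neg_one] at hk
  refine hnc ?_
  rw [← hk]
  exact inv_mul_cancel (G := End (t.pt w)) _

/-- Lengths are integers, so a finite infimum is attained: otherwise `L + 1` would be a lower bound
too. -/
theorem exists_minimal {L : ℕ} (hL : t.separatingSystole = (L : ℕ∞)) :
    (∃ (v : t.Vertex) (c : t.Walk v v), ¬ t.IsContractible c ∧ t.IsSeparating c ∧ c.length = L) ∧
      ∀ (v : t.Vertex) (c : t.Walk v v), ¬ t.IsContractible c → t.IsSeparating c →
        L ≤ c.length := by
  have h (v : t.Vertex) (c : t.Walk v v) (h₁ : ¬ t.IsContractible c) (h₂ : t.IsSeparating c) :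
      L ≤ c.length := by
    rw [← ENat.natCast_le_natCast, ← hL]
    exact iInf_le_of_le v (iInf_le_of_le c (iInf_le_of_le ⟨h₁, h₂⟩ le_rfl))
  refine ⟨?_, h⟩
  by_contra! hne
  have h2 : ((L + 1 : ℕ) : ℕ∞) ≤ t.separatingSystole := by
    refine le_iInf fun v => le_iInf fun c => le_iInf fun hc => ?_
    rw [ENat.natCast_le_natCast]
    exact Nat.lt_of_le_of_ne (h v c hc.1 hc.2) (hne v c hc.1 hc.2).symm
  rw [hL, ENat.natCast_le_natCast] at h2
  omega

end Triangulation

end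

theorem mainTheorem3 {D : Type*} [Finite D] (t : Triangulation D) (L : ℕ)
    (hL : t.separatingSystole = (L : ℕ∞)) :
    -- a simple non-contractible separating cycle
    (∃ (v : t.Vertex) (c : t.Walk v v), t.IsSimpleCycle c ∧ ¬ t.IsContractible c ∧
      t.IsSeparating c ∧ c.length ≤ L) ∨
    -- a thin eight: disjoint cycles joined by a path, or cycles touching at one vertex
    ((∃ (u v x y : t.Vertex) (c₁ : t.Walk u u) (c₂ : t.Walk v v) (p : t.Walk x y),
        t.IsThinEight c₁ c₂ p ∧ c₁.length + c₂.length + p.length ≤ L) ∨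
      (∃ (v : t.Vertex) (c₁ c₂ : t.Walk v v), t.MeetOnce c₁ c₂ ∧ ¬ t.CrossAtStart c₁ c₂ ∧
        c₁.length + c₂.length ≤ L)) ∨
    -- a fat eight: a cycle with a chord, or cycles crossing at one vertex
    ((∃ (u w : t.Vertex) (c : t.Walk u u) (p : t.Walk u w),
        t.IsFatEight c p ∧ c.length + p.length ≤ L) ∨
      (∃ (v : t.Vertex) (c₁ c₂ : t.Walk v v), t.MeetOnce c₁ c₂ ∧ t.CrossAtStart c₁ c₂ ∧
        c₁.length + c₂.length ≤ L)) := by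
  obtain ⟨⟨v, c, hnc, hsep, hlen⟩, hmin⟩ := Triangulation.exists_minimal hL
  by_cases hc : t.IsSimpleCycle c
  · exact Or.inl ⟨v, c, hc, hnc, hsep, hlen.le⟩
  refine Or.inr ?_
  change t.HasEight L
  have hpos : 0 < c.length := by
    refine Nat.pos_of_ne_zero fun h0 => hnc ?_
    rw [Quiver.Path.eq_nil_of_length_zero c h0, t.isContractible_iff, t.walkClass_nil]
  -- Setting the first edge aside before extracting the simple cycle `l` leaves it in the
  -- complementary loop, which is therefore nonempty.
  obtain ⟨y, e, p, rfl⟩ := Quiver.Path.exists_eq_toPath_comp hpos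
  have hp : ¬ p.vertices.Nodup := fun h => hc ⟨hpos, by simpa using h⟩
  obtain ⟨w, q, l, r, rfl, hl₁, hl₂, -, -⟩ := p.exists_lasso hp
  have hassoc : e.toPath.comp (q.comp (l.comp r)) = (e.toPath.comp q).comp (l.comp r) :=
    (Quiver.Path.comp_assoc _ _ _).symm
  have hassoc' : (l.comp r).comp (e.toPath.comp q) = l.comp (r.comp (e.toPath.comp q)) :=
    Quiver.Path.comp_assoc _ _ _
  rw [hassoc, Triangulation.isContractible_rotate, hassoc'] at hnc
  rw [hassoc, Triangulation.isSeparating_rotate, hassoc'] at hsep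
  have hL' : l.length + (r.comp (e.toPath.comp q)).length = L := by
    rw [← hlen]
    simp only [Quiver.Path.length_comp]
    ring
  rw [← hL'] at hmin ⊢
  refine Triangulation.hasEight_of_minimal ⟨hl₁, hl₂⟩ ?_ hnc hsep hmin
  simp only [Quiver.Path.length_comp, Quiver.Path.length_toPath]
  omega
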